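/- Let $d,n\in\mathbb N$ and let $F^2_d=\bigoplus_{k\ge 0}(\mathbb C^d)^{\otimes k}$ be the full Fock space, with canonical orthonormal basis $\{e_\alpha\}$ indexed by the words $\alpha$ in $d$ letters, vacuum vector $1=e_\emptyset$, and left creation operators $L_k f=e_k\otimes f$ ($1\le k\le d$). Let $L^\infty_d$ be the closure, in the weak operator topology, of the unital algebra generated by $L_1,\dots,L_d$. Let $Z=(Z_1,\dots,Z_d)$ be a strict row contraction on $\mathbb C^n$, that is, a $d$-tuple of complex $n\times n$ matrices for which the row operator $[Z_1,\dots,Z_d]:\mathbb C^n\otimes\mathbb C^d\to\mathbb C^n$ has norm $<1$. For a word $\alpha=i_1\cdots i_k$ put $Z^\alpha=Z_{i_1}\cdots Z_{i_k}$, and for $\phi=\phi(L)\in L^\infty_d$ put $$\phi(Z)=\sum_\alpha \phi_\alpha Z^\alpha,\qquad \phi_\alpha=\langle e_\alpha,\phi(L)1\rangle .$$ With inner products conjugate linear in the first argument, define for $y,v\in\mathbb C^n$ the kernel vector $$K\{Z,y,v\}=\sum_\alpha\langle Z^\alpha v,y\rangle\, e_\alpha\in F^2_d ,$$ and let $K_Z:\mathbb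 C^{n\times n}\to F^2_d$ be the linear map with $K_Z(yv^*)=K\{Z,y,v\}$. Then $$\bigcap\{\ker\phi(L)^* : \phi\in L^\infty_d,\ \phi(Z)=0\}=\operatorname{ran}K_Z ,$$ and for every $y\in\mathbb C^n$, $$\bigcap\{\ker\phi(L)^* : \phi\in L^\infty_d,\ \phi(Z)^*y=0\}=\{K\{Z,y,v\} : v\in\mathbb C^n\}.$$ -/

import Mathlib

open scoped InnerProductSpace

noncomputable section

/-- The full Fock space over `ℂ^d`, in the coordinates of its canonical orthonormal basis
`(e_α)`: square-summable families indexed by the words `α` in `d` letters. -/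
abbrev Fock (d : ℕ) : Type := lp (fun _ : FreeMonoid (Fin d) => ℂ) 2

namespace Fock

instance instDecidableEqWord (d : ℕ) : DecidableEq (FreeMonoid (Fin d)) :=
  inferInstanceAs (DecidableEq (List (Fin d)))

/-- The canonical basis vector `e_α = L^α 1`. -/
def basisVec {d : ℕ} (α : FreeMonoid (Fin d)) : Fock d := lp.single 2 α (1 : ℂ)

/-- The vacuum vector `1 = e_∅`. -/
def vacuum (d : ℕ) : Fock d := basisVec 1

theorem orthonormal_basisVec (d : ℕ) :
    Orthonormal ℂ (basisVec : FreeMonoid (Fin d) → Fock d) := by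
  rw [orthonormal_iff_ite]
  intro α β
  simp only [basisVec, lp.inner_single_left, lp.single_apply, Pi.single_apply]
  split_ifs <;> simp

theorem orthonormal_cons {d : ℕ} (k : Fin d) :
    Orthonormal ℂ (fun α : FreeMonoid (Fin d) => basisVec (FreeMonoid.of k * α)) :=
  (orthonormal_basisVec d).comp _ (mul_right_injective (FreeMonoid.of k))

/-- The left creation operator `L_k : f ↦ e_k ⊗ f`, i.e. `∑ f_α e_α ↦ ∑ f_α e_{kα}`. -/
def leftCreation {d : ℕ} (k : Fin d) : Fock d →L[ℂ] Fock d :=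
  (orthonormal_cons k).orthogonalFamily.linearIsometry.toContinuousLinearMap

theorem leftCreation_basisVec {d : ℕ} (k : Fin d) (α : FreeMonoid (Fin d)) :
    leftCreation k (basisVec α) = basisVec (FreeMonoid.of k * α) := by
  have h := (orthonormal_cons k).orthogonalFamily.linearIsometry_apply_single (i := α) (1 : ℂ)
  exact h.trans (one_smul ℂ _)

/-- The left free analytic Toeplitz algebra `L^∞_d`: the closure, in the weak operator topology,
of the unital algebra generated by `L_1, …, L_d`. -/
def leftToeplitz (d : ℕ) : Set (Fock d →L[ℂ] Fock d) :=
  {φ | ContinuousLinearMapWOT.ofCLM φ ∈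
    closure (ContinuousLinearMapWOT.ofCLM ''
      (Algebra.adjoin ℂ (Set.range (leftCreation (d := d))) : Set (Fock d →L[ℂ] Fock d)))}

/-- The row matrix `[Z_1, …, Z_d]`, mapping `ℂ^n ⊗ ℂ^d` to `ℂ^n`. -/
def rowMatrix {d n : ℕ} (Z : Fin d → Matrix (Fin n) (Fin n) ℂ) :
    Matrix (Fin n) (Fin d × Fin n) ℂ :=
  Matrix.of fun i p => Z p.1 i p.2

open scoped Matrix.Norms.L2Operator in
/-- The `n`-th level of the noncommutative open unit ball: the strict row contractions, i.e. the
`d`-tuples of `n × n` matrices whose row has Hilbert space operator norm `< 1`. -/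
def ncBall (d n : ℕ) : Set (Fin d → Matrix (Fin n) (Fin n) ℂ) :=
  {Z | ‖rowMatrix Z‖ < 1}

/-- `Z^α = Z_{i_1} ⋯ Z_{i_k}` for the word `α = i_1 ⋯ i_k`. -/
def wordPow {d n : ℕ} (Z : Fin d → Matrix (Fin n) (Fin n) ℂ) (α : FreeMonoid (Fin d)) :
    Matrix (Fin n) (Fin n) ℂ :=
  FreeMonoid.lift Z α

open scoped Matrix.Norms.L2Operator in
theorem sum_norm_sq_conjTranspose_le {d n : ℕ} (Z : Fin d → Matrix (Fin n) (Fin n) ℂ)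
    (y : EuclideanSpace ℂ (Fin n)) :
    ∑ k, ‖Matrix.toEuclideanLin (Z k).conjTranspose y‖ ^ 2 ≤ ‖rowMatrix Z‖ ^ 2 * ‖y‖ ^ 2 := by
  have h := Matrix.l2_opNorm_mulVec (rowMatrix Z).conjTranspose y
  rw [Matrix.l2_opNorm_conjTranspose] at h
  have h2 := pow_le_pow_left₀ (norm_nonneg _) h 2
  rw [mul_pow, EuclideanSpace.norm_sq_eq, Fintype.sum_prod_type] at h2
  refine le_trans (le_of_eq ?_) h2
  refine Finset.sum_congr rfl fun k _ => ?_
  rw [EuclideanSpace.norm_sq_eq]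
  rfl

/-- The words of length at most `N`. -/
def wordsUpTo (d : ℕ) : ℕ → Finset (FreeMonoid (Fin d))
  | 0 => {1}
  | N + 1 => insert 1
      ((Finset.univ ×ˢ wordsUpTo d N).image fun p => FreeMonoid.of p.1 * p.2)

theorem mem_wordsUpTo {d : ℕ} (N : ℕ) (α : FreeMonoid (Fin d)) (h : α.length ≤ N) :
    α ∈ wordsUpTo d N := by
  induction N generalizing α with
  | zero =>
    have : α = 1 := FreeMonoid.length_eq_zero.mp (by omega)
    simp [wordsUpTo, this]
  | succ N ih =>
    induction α using FreeMonoid.casesOn with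
    | one => simp [wordsUpTo]
    | of_mul k β =>
      have hb : β.length ≤ N := by
        rw [FreeMonoid.length_mul, FreeMonoid.length_of] at h
        omega
      simp only [wordsUpTo, Finset.mem_insert, Finset.mem_image]
      exact Or.inr ⟨(k, β), by simp [ih β hb], rfl⟩

theorem sum_wordsUpTo_succ_le {d : ℕ} (N : ℕ) (F : FreeMonoid (Fin d) → ℝ) :
    ∑ α ∈ wordsUpTo d (N + 1), F α ≤
      F 1 + ∑ k, ∑ α ∈ wordsUpTo d N, F (FreeMonoid.of k * α) := by
  have h1 : (1 : FreeMonoid (Fin d)) ∉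
      (Finset.univ ×ˢ wordsUpTo d N).image fun p => FreeMonoid.of p.1 * p.2 := by
    intro h
    obtain ⟨p, -, hp⟩ := Finset.mem_image.mp h
    have := congrArg FreeMonoid.length hp
    simp only [FreeMonoid.length_mul, FreeMonoid.length_of, FreeMonoid.length_one] at this
    omega
  rw [wordsUpTo, Finset.sum_insert h1, Finset.sum_image, Finset.sum_product]
  rintro ⟨k, α⟩ - ⟨l, β⟩ - h
  have h' : k :: FreeMonoid.toList α = l :: FreeMonoid.toList β := h
  injection h' with hk ha
  exact Prod.ext hk ha

open scoped Matrix.Norms.L2Operator in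
theorem sum_wordPow_le {d n : ℕ} {Z : Fin d → Matrix (Fin n) (Fin n) ℂ} (hZ : Z ∈ ncBall d n)
    (N : ℕ) (y : EuclideanSpace ℂ (Fin n)) :
    ∑ α ∈ wordsUpTo d N, ‖Matrix.toEuclideanLin (wordPow Z α).conjTranspose y‖ ^ 2 ≤
      (1 - ‖rowMatrix Z‖ ^ 2)⁻¹ * ‖y‖ ^ 2 := by
  have hr : ‖rowMatrix Z‖ < 1 := hZ
  have hr0 : 0 ≤ ‖rowMatrix Z‖ := norm_nonneg _
  have hpos : 0 < 1 - ‖rowMatrix Z‖ ^ 2 := by nlinarith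
  have h1 : ∀ y, Matrix.toEuclideanLin (wordPow Z 1).conjTranspose y = y := by
    intro y
    simp [wordPow, Matrix.toLpLin_one]
  have hC : 1 ≤ (1 - ‖rowMatrix Z‖ ^ 2)⁻¹ := (one_le_inv₀ hpos).mpr (by nlinarith)
  induction N generalizing y with
  | zero =>
    simp only [wordsUpTo, Finset.sum_singleton]
    rw [h1]
    nlinarith [sq_nonneg ‖y‖]
  | succ N ih =>
    refine (sum_wordsUpTo_succ_le N _).trans ?_
    have h2 : ∀ (k : Fin d) (α : FreeMonoid (Fin d)),
        Matrix.toEuclideanLin (wordPow Z (FreeMonoid.of k * α)).conjTranspose y =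
          Matrix.toEuclideanLin (wordPow Z α).conjTranspose
            (Matrix.toEuclideanLin (Z k).conjTranspose y) := by
      intro k α
      have : wordPow Z (FreeMonoid.of k * α) = Z k * wordPow Z α := by simp [wordPow]
      rw [this, Matrix.conjTranspose_mul]
      ext i
      simp [Matrix.toLpLin_apply, Matrix.mulVec_mulVec]
    have h1' := h1 y
    simp only [h2]
    rw [h1']
    have h3 : ∑ k, ∑ α ∈ wordsUpTo d N, ‖Matrix.toEuclideanLin (wordPow Z α).conjTranspose
            (Matrix.toEuclideanLin (Z k).conjTranspose y)‖ ^ 2 ≤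
        (1 - ‖rowMatrix Z‖ ^ 2)⁻¹ * (‖rowMatrix Z‖ ^ 2 * ‖y‖ ^ 2) := by
      refine (Finset.sum_le_sum fun k _ => ih _).trans ?_
      rw [← Finset.mul_sum]
      exact mul_le_mul_of_nonneg_left (sum_norm_sq_conjTranspose_le Z y) (by linarith)
    have h4 : (1 - ‖rowMatrix Z‖ ^ 2)⁻¹ * (‖rowMatrix Z‖ ^ 2 * ‖y‖ ^ 2) + ‖y‖ ^ 2 =
        (1 - ‖rowMatrix Z‖ ^ 2)⁻¹ * ‖y‖ ^ 2 := by
      field_simp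
      ring
    linarith

open scoped Matrix.Norms.L2Operator in
theorem memℓp_kernelVec {d n : ℕ} {Z : Fin d → Matrix (Fin n) (Fin n) ℂ} (hZ : Z ∈ ncBall d n)
    (y v : EuclideanSpace ℂ (Fin n)) :
    Memℓp (fun α : FreeMonoid (Fin d) =>
      inner ℂ (Matrix.toEuclideanLin (wordPow Z α) v) y) 2 := by
  classical
  refine memℓp_gen' (C := ‖v‖ ^ 2 * ((1 - ‖rowMatrix Z‖ ^ 2)⁻¹ * ‖y‖ ^ 2)) fun s => ?_
  have hs : s ⊆ wordsUpTo d (s.sup FreeMonoid.length) := fun α hα =>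
    mem_wordsUpTo _ _ (Finset.le_sup (f := FreeMonoid.length) hα)
  refine le_trans ?_ (mul_le_mul_of_nonneg_left
    (sum_wordPow_le hZ (s.sup FreeMonoid.length) y) (sq_nonneg ‖v‖))
  rw [Finset.mul_sum]
  refine le_trans (Finset.sum_le_sum fun α _ => ?_)
    (Finset.sum_le_sum_of_subset_of_nonneg hs fun α _ _ => by positivity)
  have h : inner ℂ (Matrix.toEuclideanLin (wordPow Z α) v) y =
      inner ℂ v (Matrix.toEuclideanLin (wordPow Z α).conjTranspose y) := by
    rw [Matrix.toEuclideanLin_conjTranspose_eq_adjoint, LinearMap.adjoint_inner_right]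
  rw [h, ← mul_pow]
  simp only [ENNReal.toReal_ofNat, Real.rpow_ofNat]
  exact pow_le_pow_left₀ (norm_nonneg _) (norm_inner_le_norm _ _) 2

/-- The kernel vector `K{Z, y, v} = ∑_α ⟨Z^α v, y⟩ e_α` (inner products are conjugate linear in
the first argument). -/
def kernelVec {d n : ℕ} (Z : ncBall d n) (y v : EuclideanSpace ℂ (Fin n)) : Fock d :=
  ⟨_, memℓp_kernelVec Z.2 y v⟩

/-- The kernel map `K_Z : ℂ^{n × n} → F²_d`, the linear map with `K_Z (y v^*) = K{Z, y, v}`; here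
it is written in the basis of matrix units `ε_i ε_j^*`. -/
def kernelMap {d n : ℕ} (Z : ncBall d n) : Matrix (Fin n) (Fin n) ℂ →ₗ[ℂ] Fock d where
  toFun A := ∑ i, ∑ j, A i j •
    kernelVec Z (EuclideanSpace.single i 1) (EuclideanSpace.single j 1)
  map_add' A B := by
    simp only [Matrix.add_apply, add_smul, Finset.sum_add_distrib]
  map_smul' c A := by
    simp only [Matrix.smul_apply, smul_eq_mul, mul_smul, Finset.smul_sum, RingHom.id_apply]

theorem sum_coeff {d : ℕ} {ι : Type} (s : Finset ι) (f : ι → Fock d) (α : FreeMonoid (Fin d)) :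
    (∑ i ∈ s, f i : Fock d) α = ∑ i ∈ s, f i α := by
  rw [lp.coeFn_sum]
  exact Finset.sum_apply α s fun i => (f i : FreeMonoid (Fin d) → ℂ)

theorem kernelMap_vecMulVec {d n : ℕ} (Z : ncBall d n) (y v : EuclideanSpace ℂ (Fin n)) :
    kernelMap Z (Matrix.vecMulVec y (star (v : Fin n → ℂ))) = kernelVec Z y v := by
  ext α
  have hM : ∀ u : EuclideanSpace ℂ (Fin n), ∀ x : EuclideanSpace ℂ (Fin n),
      inner ℂ (Matrix.toEuclideanLin (wordPow Z.1 α) u) x =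
        ∑ i, ∑ j, x i * star (u j) * star (wordPow Z.1 α i j) := by
    intro u x
    rw [PiLp.inner_apply]
    refine Finset.sum_congr rfl fun i _ => ?_
    simp only [Matrix.toLpLin_apply, Matrix.mulVec, dotProduct, RCLike.inner_apply, map_sum,
      map_mul, Finset.mul_sum]
    refine Finset.sum_congr rfl fun j _ => ?_
    simp only [RCLike.star_def]
    ring
  have hK : ∀ x u : EuclideanSpace ℂ (Fin n), (kernelVec Z x u) α =
      inner ℂ (Matrix.toEuclideanLin (wordPow Z.1 α) u) x := fun _ _ => rfl
  have hL : (kernelMap Z (Matrix.vecMulVec y (star (v : Fin n → ℂ)))) α =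
      ∑ i, ∑ j, y i * star (v j) *
        (kernelVec Z (EuclideanSpace.single i 1) (EuclideanSpace.single j 1)) α := by
    simp only [kernelMap, LinearMap.coe_mk, AddHom.coe_mk, sum_coeff, lp.coeFn_smul,
      Pi.smul_apply, smul_eq_mul, Matrix.vecMulVec_apply, Pi.star_apply]
  rw [hL, hK, hM]
  refine Finset.sum_congr rfl fun i _ => Finset.sum_congr rfl fun j _ => ?_
  rw [hK, hM]
  congr 1
  simp

/-- The value `f(Z) = ∑_α f_α Z^α` at `Z` of the free holomorphic function of `f ∈ F²_d`. -/
def eval {d n : ℕ} (f : Fock d) (Z : ncBall d n) : Matrix (Fin n) (Fin n) ℂ :=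
  ∑' α : FreeMonoid (Fin d), f α • wordPow Z.1 α

theorem summable_eval {d n : ℕ} (f : Fock d) (Z : ncBall d n) :
    Summable fun α : FreeMonoid (Fin d) => f α • wordPow Z.1 α := by
  refine Pi.summable.mpr fun i => Pi.summable.mpr fun j => ?_
  refine (lp.summable_inner (kernelVec Z (EuclideanSpace.single i 1)
    (EuclideanSpace.single j 1)) f).congr fun α => ?_
  have h : (kernelVec Z (EuclideanSpace.single i 1) (EuclideanSpace.single j 1)) α =
      inner ℂ (Matrix.toEuclideanLin (wordPow Z.1 α) (EuclideanSpace.single j 1))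
        (EuclideanSpace.single i 1) := rfl
  rw [h]
  simp [EuclideanSpace.inner_single_right]

/-- The value `φ(Z) = ∑_α φ_α Z^α`, `φ_α = ⟨e_α, φ 1⟩`, at `Z` of an operator `φ` on `F²_d`
(used for `φ = φ(L)` in `L^∞_d`): the value of the symbol `φ 1`. -/
def opEval {d n : ℕ} (φ : Fock d →L[ℂ] Fock d) (Z : ncBall d n) : Matrix (Fin n) (Fin n) ℂ :=
  eval (φ (vacuum d)) Z

/-- `E_Z = ⋂ {ker φ(L)^* : φ ∈ L^∞_d, φ(Z) = 0}`. -/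
def nullSpace {d n : ℕ} (Z : ncBall d n) : Submodule ℂ (Fock d) :=
  ⨅ φ ∈ {φ ∈ leftToeplitz d | opEval φ Z = 0}, (ContinuousLinearMap.adjoint φ).ker

/-- `E_{Z,y} = ⋂ {ker φ(L)^* : φ ∈ L^∞_d, φ(Z)^* y = 0}`. -/
def nullSpaceAt {d n : ℕ} (Z : ncBall d n) (y : EuclideanSpace ℂ (Fin n)) :
    Submodule ℂ (Fock d) :=
  ⨅ φ ∈ {φ ∈ leftToeplitz d | Matrix.toEuclideanLin (opEval φ Z).conjTranspose y = 0},
    (ContinuousLinearMap.adjoint φ).ker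

end Fock

end

noncomputable section

namespace Fock

variable {d n : ℕ}

/-! Two facts give the inclusion `⊇`: the reproducing property `⟨K{Z,y,v}, f⟩ = ⟨y, f(Z)v⟩`, and
multiplicativity `(φf)(Z) = φ(Z)f(Z)` for `φ ∈ L^∞_d`. Together they yield `⟨φ^*K{Z,y,v}, f⟩ =
⟨φ(Z)^*y, f(Z)v⟩`, which vanishes when `φ(Z)^*y = 0`.

For `⊆`, free polynomials suffice as test operators. If `φ^*g = 0` for each polynomial `φ` with
`T(φ(Z)) = 0`, then `⟨g, φ1⟩ = ⟨φ^*g, 1⟩ = 0`. So `φ ↦ ⟨g, φ1⟩` factors through `φ ↦ T(φ(Z))`, and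
monomials read off the coefficients of `g` (`exists_dual_of_adjoint_eq_zero`). Taking `T = id` gives
`ran K_Z`; taking `T(M) = y^*M` gives the vectors `K{Z,y,v}`. -/

theorem hasSum_basisVec (f : Fock d) : HasSum (fun α => f α • basisVec α) f := by
  have h := lp.hasSum_single (p := 2) (by simp) f
  refine h.congr_fun fun α => ?_
  rw [basisVec, ← lp.single_smul, smul_eq_mul, mul_one]

theorem basisVec_apply (α β : FreeMonoid (Fin d)) :
    (basisVec α : Fock d) β = if β = α then 1 else 0 := by
  simp [basisVec, lp.single_apply, Pi.single_apply]

theorem inner_basisVec (g : Fock d) (α : FreeMonoid (Fin d)) :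
    inner ℂ g (basisVec α) = star (g α) := by
  rw [basisVec, lp.inner_single_right]
  simp

theorem inner_kernelVec (Z : ncBall d n) (y v : EuclideanSpace ℂ (Fin n)) (f : Fock d) :
    inner ℂ (kernelVec Z y v) f = inner ℂ y (Matrix.toEuclideanLin (eval f Z) v) := by
  -- The functional `M ↦ ⟨y, Mv⟩` has finite-dimensional domain, so it is continuous and passes
  -- through the series for `f(Z)`.
  let T : Matrix (Fin n) (Fin n) ℂ →ₗ[ℂ] ℂ :=
    (innerSL ℂ y).toLinearMap ∘ₗ LinearMap.applyₗ v ∘ₗ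
      (Matrix.toEuclideanLin (𝕜 := ℂ) (m := Fin n) (n := Fin n)).toLinearMap
  have h := (summable_eval f Z).hasSum.map T.toAddMonoidHom T.continuous_of_finiteDimensional
  have h2 := lp.hasSum_inner (𝕜 := ℂ) (kernelVec Z y v) f
  refine h2.unique (h.congr_fun fun α => ?_)
  have hT : T (f α • wordPow Z.1 α) =
      f α * inner ℂ y (Matrix.toEuclideanLin (wordPow Z.1 α) v) := by
    rw [map_smul]
    rfl
  refine Eq.trans ?_ hT.symm
  have hK : (kernelVec Z y v) α = inner ℂ (Matrix.toEuclideanLin (wordPow Z.1 α) v) y := rfl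
  rw [hK, RCLike.inner_apply, inner_conj_symm]

/-- Each entry is an inner product against a fixed vector; this is the source of linearity, norm
continuity and weak operator continuity of evaluation. -/
theorem eval_apply (Z : ncBall d n) (f : Fock d) (i j : Fin n) :
    eval f Z i j = inner ℂ (kernelVec Z (EuclideanSpace.single i 1)
      (EuclideanSpace.single j 1)) f := by
  rw [inner_kernelVec]
  simp [EuclideanSpace.inner_single_left]

/-- Evaluation at `Z` as a linear map on the Fock space. -/
def evalLin (Z : ncBall d n) : Fock d →ₗ[ℂ] Matrix (Fin n) (Fin n) ℂ where
  toFun f := eval f Z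
  map_add' f g := by
    ext i j
    simp only [Matrix.add_apply, eval_apply, inner_add_right]
  map_smul' c f := by
    ext i j
    simp only [Matrix.smul_apply, eval_apply, inner_smul_right, smul_eq_mul, RingHom.id_apply]

theorem evalLin_apply (Z : ncBall d n) (f : Fock d) : evalLin Z f = eval f Z := rfl

theorem continuous_evalLin (Z : ncBall d n) : Continuous (evalLin Z) := by
  refine continuous_pi fun i => continuous_pi fun j => ?_
  simp only [evalLin_apply, eval_apply]
  fun_prop

theorem eval_basisVec (Z : ncBall d n) (α : FreeMonoid (Fin d)) :
    eval (basisVec α) Z = wordPow Z.1 α := by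
  rw [eval, tsum_eq_single α]
  · simp [basisVec_apply]
  · intro β hβ
    simp [basisVec_apply, hβ]

theorem eval_vacuum (Z : ncBall d n) : eval (vacuum d) Z = 1 := by
  rw [vacuum, eval_basisVec, wordPow, map_one]

theorem wordPow_of_mul (Z : Fin d → Matrix (Fin n) (Fin n) ℂ) (k : Fin d)
    (α : FreeMonoid (Fin d)) : wordPow Z (FreeMonoid.of k * α) = Z k * wordPow Z α := by
  simp [wordPow]

theorem eval_leftCreation (Z : ncBall d n) (k : Fin d) (f : Fock d) :
    eval (leftCreation k f) Z = Z.1 k * eval f Z := by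
  have h1 := ((hasSum_basisVec f).map (leftCreation k) (leftCreation k).continuous).map
    (evalLin Z) (continuous_evalLin Z)
  have h2 := ((hasSum_basisVec f).map (evalLin Z) (continuous_evalLin Z)).map
    (AddMonoidHom.mulLeft (Z.1 k)) (continuous_const.mul continuous_id)
  refine h1.unique (h2.congr_fun fun α => ?_)
  simp only [Function.comp_apply, map_smul, leftCreation_basisVec, evalLin_apply, eval_basisVec,
    AddMonoidHom.coe_mulLeft, wordPow_of_mul, mul_smul_comm]

/-- Evaluation at `Z` is multiplicative on the algebra generated by the creation operators. -/
theorem eval_apply_of_mem_adjoin (Z : ncBall d n) {φ : Fock d →L[ℂ] Fock d}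
    (hφ : φ ∈ Algebra.adjoin ℂ (Set.range (leftCreation (d := d)))) (f : Fock d) :
    eval (φ f) Z = opEval φ Z * eval f Z := by
  -- The product case uses the rule for `φ` at both `ψ f` and `ψ 1`, so the induction must be
  -- uniform in `f`.
  induction hφ using Algebra.adjoin_induction generalizing f with
  | mem φ h =>
    obtain ⟨k, rfl⟩ := h
    rw [opEval, eval_leftCreation, eval_leftCreation, eval_vacuum, mul_one]
  | algebraMap c =>
    simp only [opEval, Algebra.algebraMap_eq_smul_one, smul_apply,
      one_apply_eq_self, ← evalLin_apply, map_smul]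
    rw [evalLin_apply Z (vacuum d), eval_vacuum, smul_mul_assoc, one_mul]
  | add φ ψ _ _ hφ hψ =>
    simp only [opEval, add_apply, ← evalLin_apply, map_add, add_mul]
      at hφ hψ ⊢
    rw [hφ, hψ]
  | mul φ ψ _ _ hφ hψ =>
    simp only [opEval, mul_apply_eq_comp] at hφ hψ ⊢
    rw [hφ, hψ, hφ (ψ (vacuum d)), mul_assoc]

/-- Evaluation at `Z` is multiplicative on the left free analytic Toeplitz algebra. -/
theorem eval_apply_of_mem_leftToeplitz (Z : ncBall d n) {φ : Fock d →L[ℂ] Fock d}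
    (hφ : φ ∈ leftToeplitz d) (f : Fock d) :
    eval (φ f) Z = opEval φ Z * eval f Z := by
  -- The entries of `(Ag)(Z)` are matrix coefficients of `A`, so the product rule is a WOT-closed
  -- condition and survives the closure.
  have hcont : ∀ g : Fock d, Continuous fun A : Fock d →WOT[ℂ] Fock d => eval (A g) Z := by
    intro g
    refine continuous_pi fun i => continuous_pi fun j => ?_
    simp only [eval_apply]
    exact ContinuousLinearMapWOT.continuous_iff.mp continuous_id _ _
  have hclosed : IsClosed {A : Fock d →WOT[ℂ] Fock d |
      eval (A f) Z = eval (A (vacuum d)) Z * eval f Z} :=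
    isClosed_eq (hcont f) ((hcont _).mul continuous_const)
  refine closure_minimal ?_ hclosed hφ
  rintro _ ⟨ψ, hψ, rfl⟩
  exact eval_apply_of_mem_adjoin Z hψ f

/-- The operator `∑ p_α L^α` of a free polynomial `p`. -/
def polyOp (d : ℕ) : (FreeMonoid (Fin d) →₀ ℂ) →ₗ[ℂ] (Fock d →L[ℂ] Fock d) :=
  Finsupp.linearCombination ℂ (FreeMonoid.lift leftCreation)

theorem lift_leftCreation_vacuum (α : FreeMonoid (Fin d)) :
    FreeMonoid.lift leftCreation α (vacuum d) = basisVec α := by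
  induction α using FreeMonoid.inductionOn' with
  | one => simp [vacuum]
  | of_mul k α ih =>
    rw [map_mul, FreeMonoid.lift_eval_of, mul_apply_eq_comp, ih,
      leftCreation_basisVec]

theorem polyOp_mem_leftToeplitz (p : FreeMonoid (Fin d) →₀ ℂ) : polyOp d p ∈ leftToeplitz d := by
  refine subset_closure ⟨_, ?_, rfl⟩
  rw [polyOp, Finsupp.linearCombination_apply]
  refine Subalgebra.sum_mem _ fun α hα => Subalgebra.smul_mem _ ?_ _
  clear hα
  induction α using FreeMonoid.inductionOn' with
  | one => simp [one_mem]
  | of_mul k α ih =>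
    rw [map_mul, FreeMonoid.lift_eval_of]
    exact mul_mem (Algebra.subset_adjoin ⟨k, rfl⟩) ih

theorem polyOp_single_vacuum (α : FreeMonoid (Fin d)) :
    polyOp d (Finsupp.single α 1) (vacuum d) = basisVec α := by
  simp [polyOp, lift_leftCreation_vacuum]

/-- If `g` is annihilated by `φ(L)^*` for every free polynomial `φ` such that `T (φ(Z)) = 0`, then
the coefficients of `g` are given by a linear functional of `T (Z^α)`. -/
theorem exists_dual_of_adjoint_eq_zero {W : Type*} [AddCommGroup W] [Module ℂ W] (Z : ncBall d n)
    (T : Matrix (Fin n) (Fin n) ℂ →ₗ[ℂ] W) {g : Fock d}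
    (hg : ∀ φ ∈ leftToeplitz d, T (opEval φ Z) = 0 → ContinuousLinearMap.adjoint φ g = 0) :
    ∃ l : Module.Dual ℂ W, ∀ α, star (g α) = l (T (wordPow Z.1 α)) := by
  let V : (FreeMonoid (Fin d) →₀ ℂ) →ₗ[ℂ] Fock d := LinearMap.applyₗ (vacuum d) ∘ₗ
    ContinuousLinearMap.coeLM ℂ ∘ₗ polyOp d
  have hV : ∀ p, V p = polyOp d p (vacuum d) := fun _ => rfl
  -- A functional vanishing on the kernel of a linear map factors through that map; this is pure
  -- algebra, with no density or closure argument.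
  have hmem : (innerSL ℂ g).toLinearMap ∘ₗ V ∈
      LinearMap.range (T ∘ₗ evalLin Z ∘ₗ V).dualMap := by
    rw [LinearMap.range_dualMap_eq_dualAnnihilator_ker, Submodule.mem_dualAnnihilator]
    intro p hp
    have h := hg _ (polyOp_mem_leftToeplitz p) hp
    change inner ℂ g (V p) = 0
    rw [hV, ← ContinuousLinearMap.adjoint_inner_left, h, inner_zero_left]
  obtain ⟨l, hl⟩ := hmem
  refine ⟨l, fun α => ?_⟩
  have h := LinearMap.congr_fun hl (Finsupp.single α 1)
  change l (T (eval (V (Finsupp.single α 1)) Z)) = inner ℂ g (V (Finsupp.single α 1)) at h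
  rw [hV, polyOp_single_vacuum, eval_basisVec, inner_basisVec] at h
  exact h.symm

theorem mem_nullSpace (Z : ncBall d n) (g : Fock d) : g ∈ nullSpace Z ↔
    ∀ φ ∈ leftToeplitz d, opEval φ Z = 0 → ContinuousLinearMap.adjoint φ g = 0 := by
  simp [nullSpace, Submodule.mem_iInf]

theorem mem_nullSpaceAt (Z : ncBall d n) (y : EuclideanSpace ℂ (Fin n)) (g : Fock d) :
    g ∈ nullSpaceAt Z y ↔ ∀ φ ∈ leftToeplitz d,
      Matrix.toEuclideanLin (opEval φ Z).conjTranspose y = 0 →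
        ContinuousLinearMap.adjoint φ g = 0 := by
  simp only [nullSpaceAt, Submodule.mem_iInf, Set.mem_ofPred_eq, and_imp, LinearMap.mem_ker]
  rfl

/-- `K{Z, y, v}` lies in the kernel of `φ(L)^*` whenever `φ(Z)^* y = 0`. -/
theorem kernelVec_mem_nullSpaceAt (Z : ncBall d n) (y v : EuclideanSpace ℂ (Fin n)) :
    kernelVec Z y v ∈ nullSpaceAt Z y := by
  rw [mem_nullSpaceAt]
  intro φ hφ h
  refine ext_inner_right ℂ fun f => ?_
  have hmul : Matrix.toEuclideanLin (opEval φ Z * eval f Z) v =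
      Matrix.toEuclideanLin (opEval φ Z) (Matrix.toEuclideanLin (eval f Z) v) := by
    ext i
    simp [Matrix.toLpLin_apply, Matrix.mulVec_mulVec]
  rw [ContinuousLinearMap.adjoint_inner_left, inner_kernelVec,
    eval_apply_of_mem_leftToeplitz Z hφ, hmul, ← LinearMap.adjoint_inner_left,
    ← Matrix.toEuclideanLin_conjTranspose_eq_adjoint, h, inner_zero_left, inner_zero_left]

/-- If `φ(Z) = 0` then `φ(Z)^*y = 0`, so the left side intersects more kernels. -/
theorem nullSpaceAt_le_nullSpace (Z : ncBall d n) (y : EuclideanSpace ℂ (Fin n)) :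
    nullSpaceAt Z y ≤ nullSpace Z := by
  intro g hg
  rw [mem_nullSpaceAt] at hg
  rw [mem_nullSpace]
  intro φ hφ h
  exact hg φ hφ (by simp [h])

theorem range_kernelMap_le_nullSpace (Z : ncBall d n) :
    LinearMap.range (kernelMap Z) ≤ nullSpace Z := by
  rintro _ ⟨A, rfl⟩
  change ∑ i, ∑ j, A i j • kernelVec Z (EuclideanSpace.single i 1)
    (EuclideanSpace.single j 1) ∈ nullSpace Z
  exact Submodule.sum_mem _ fun i _ => Submodule.sum_mem _ fun j _ => Submodule.smul_mem _ _
    (nullSpaceAt_le_nullSpace Z _ (kernelVec_mem_nullSpaceAt Z _ _))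

theorem kernelMap_coeff (Z : ncBall d n) (A : Matrix (Fin n) (Fin n) ℂ)
    (α : FreeMonoid (Fin d)) :
    kernelMap Z A α = ∑ i, ∑ j, A i j * star (wordPow Z.1 α i j) := by
  have hK : ∀ x u : EuclideanSpace ℂ (Fin n), (kernelVec Z x u) α =
      inner ℂ (Matrix.toEuclideanLin (wordPow Z.1 α) u) x := fun _ _ => rfl
  simp only [kernelMap, LinearMap.coe_mk, AddHom.coe_mk, sum_coeff, lp.coeFn_smul,
    Pi.smul_apply, smul_eq_mul, hK]
  simp [EuclideanSpace.inner_single_right]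

theorem nullSpace_le_range_kernelMap (Z : ncBall d n) :
    nullSpace Z ≤ LinearMap.range (kernelMap Z) := by
  intro g hg
  rw [mem_nullSpace] at hg
  obtain ⟨l, hl⟩ := exists_dual_of_adjoint_eq_zero Z LinearMap.id hg
  -- The conjugate appears because the coefficients of `K_Z A` are linear in `A` and conjugate
  -- linear in the entries of `Z^α`.
  refine ⟨Matrix.of fun i j => star (l (Matrix.single i j 1)), ?_⟩
  ext α
  rw [kernelMap_coeff, ← star_star (g α), hl, LinearMap.id_apply]
  conv_rhs => rw [Matrix.matrix_eq_sum_single (wordPow Z.1 α)]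
  simp only [map_sum, star_sum]
  refine Finset.sum_congr rfl fun i _ => Finset.sum_congr rfl fun j _ => ?_
  rw [← mul_one (wordPow Z.1 α i j), ← smul_eq_mul (wordPow Z.1 α i j) (1 : ℂ),
    ← Matrix.smul_single, map_smul]
  simp [mul_comm]

theorem exists_kernelVec_of_mem_nullSpaceAt (Z : ncBall d n) (y : EuclideanSpace ℂ (Fin n))
    {g : Fock d} (hg : g ∈ nullSpaceAt Z y) : ∃ v, kernelVec Z y v = g := by
  rw [mem_nullSpaceAt] at hg
  -- The row `y^*M` is the conjugate transpose of `M^*y`, so `T(M) = y^*M` encodes the defining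
  -- condition by a map that is linear in `M`.
  have hT : ∀ M : Matrix (Fin n) (Fin n) ℂ, Matrix.vecMulBilin ℂ ℂ (star (y : Fin n → ℂ)) M = 0 →
      Matrix.toEuclideanLin M.conjTranspose y = 0 := by
    intro M h
    have h' : Matrix.vecMul (star (y : Fin n → ℂ)) M = 0 := h
    have h2 := congrArg star h'
    rw [Matrix.star_vecMul, star_star, star_zero] at h2
    rw [Matrix.toLpLin_apply, h2]
    rfl
  obtain ⟨l, hl⟩ := exists_dual_of_adjoint_eq_zero Z
    (Matrix.vecMulBilin ℂ ℂ (star (y : Fin n → ℂ))) fun φ hφ h => hg φ hφ (hT _ h)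
  -- With `v_j = l(ε_j)`, the functional is `l(w) = ∑ w_j v_j`, so `l(y^*Z^α) = ⟨y, Z^αv⟩`, the
  -- conjugate of the coefficient of `K{Z,y,v}`.
  refine ⟨WithLp.toLp 2 fun j => l fun k => if j = k then 1 else 0, ?_⟩
  ext α
  rw [← star_star (g α), hl, LinearMap.pi_apply_eq_sum_univ l]
  change inner ℂ (Matrix.toEuclideanLin (wordPow Z.1 α) _) y = star (∑ j,
    Matrix.vecMul (star (y : Fin n → ℂ)) (wordPow Z.1 α) j • l _)
  simp only [PiLp.inner_apply, RCLike.inner_apply, Matrix.toLpLin_apply, Matrix.mulVec,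
    Matrix.vecMul, dotProduct, map_sum, map_mul, star_sum, smul_eq_mul, star_mul', Pi.star_apply,
    Finset.mul_sum, Finset.sum_mul, RCLike.star_def, RCLike.conj_conj]
  rw [Finset.sum_comm]
  simp only [mul_assoc]

end Fock

end

theorem corollary6p5 (d n : ℕ) (Z : Fock.ncBall d n) :
    Fock.nullSpace Z = LinearMap.range (Fock.kernelMap Z) ∧
    ∀ y : EuclideanSpace ℂ (Fin n),
      (Fock.nullSpaceAt Z y : Set (Fock d)) = Set.range (fun v => Fock.kernelVec Z y v) := by
  refine ⟨le_antisymm (Fock.nullSpace_le_range_kernelMap Z)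
    (Fock.range_kernelMap_le_nullSpace Z), fun y => Set.Subset.antisymm ?_ ?_⟩
  · exact fun g hg => Fock.exists_kernelVec_of_mem_nullSpaceAt Z y hg
  · rintro _ ⟨v, rfl⟩
    exact Fock.kernelVec_mem_nullSpaceAt Z y v
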